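/- Let $p>3$ be a prime, let $c_0=\{(x_n)_{n\ge1}\subset\mathbb Q_p:\ \lim_{n\to\infty} x_n=0\}$ and let $\lambda=(\lambda_n)\in c_0$. Let $F$ be the operator $(Fx)_n=\lambda_n\bigl(1+\sum_{m\ge1}x_m\bigr)^{-2}$, defined for those $x\in c_0$ with $\sum_{m\ge 1} x_m\ne-1$, and let $|\mathrm{Fix}(F)|$ be the number of (distinct) points $x\in c_0$, $\sum_m x_m\neq -1$, with $Fx=x$. Every $x\in\mathbb Q_p\setminus\{0\}$ has a unique form $x=p^{\mathrm{ord}_p x}(x_0+x_1p+x_2p^2+\cdots)$ with $x_j\in\{0,\dots,p-1\}$ and $x_0\neq0$; call $x_0$ its leading digit. Put $\theta=\sum_{n\ge1}\lambda_n$, $b=\theta+\frac{2}{27}$ and $D=\frac{4}{27}-27\,b^2|b|_p^2$, where $|b|_p=p^{-\mathrm{ord}_p b}$ is regarded as a rational number. Let $a_0,b_0,d_0$ be the leading digits of $-\frac13$, of $b$ (if $b\ne0$) and of $D$ (if $D\neq0$). Put $D_0=-4a_0^3-27b_0^2$ and $u_1=0$, $u_2=-a_0$, $u_3=b_0$, $u_{n+3}=b_0u_n-a_0u_{n+1}$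 for $n\ge1$. Then $|\mathrm{Fix}(F)|=3$ if one of the following holds: - $|b|_p>1$, $3\mid\mathrm{ord}_p b$, $p\equiv1\pmod 3$ and $b_0^{(p-1)/3}\equiv1\pmod p$; - $|b|_p=1$, $0<|D|_p<1$, $2\mid\mathrm{ord}_pD$ and $d_0^{(p-1)/2}\equiv1\pmod p$; - $|b|_p=1$, $|D|_p=1$ and $u_{p-2}\equiv0\pmod p$; - $|b|_p<1$ and $(-a_0)^{(p-1)/2}\equiv1\pmod p$. $|\mathrm{Fix}(F)|=2$ if $|b|_p=1$, $D=0$ and $\theta\ne0$ (that is, $\theta=-\frac{4}{27}$). $|\mathrm{Fix}(F)|=1$ if one of the following holds: - $|b|_p=1$, $D=0$ and $\theta=0$; - $|b|_p>1$, $3\mid\mathrm{ord}_pb$ and $p\equiv2\pmod 3$; - $|b|_p=1$, $0<|D|_p<1$, $2\mid\mathrm{ord}_pD$ and $d_0^{(p-1)/2}\not\equiv1\pmod p$; - $|b|_p=1$, $0<|D|_p<1$ and $2\nmid\mathrm{ord}_pD$; - $|b|_p=1$, $D_0u_{p-2}^2\not\equiv0\pmod p$ and $D_0u_{p-2}^2\not\equiv9a_0^2\pmod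 p$; - $|b|_p<1$ and $(-a_0)^{(p-1)/2}\not\equiv1\pmod p$. In all other cases $|\mathrm{Fix}(F)|=0$. -/

import Mathlib

open Filter Topology

/-- The space `c₀` of sequences in `ℚ_p` that tend to zero. -/
def c0 (p : ℕ) [Fact p.Prime] : Set (ℕ → ℚ_[p]) :=
  {x | Tendsto x atTop (𝓝 0)}

/-- The sum of the series `∑ xₙ` of a sequence in `c₀`
(the series converges because `ℚ_p` is complete and non-archimedean). -/
noncomputable def seriesSum {p : ℕ} [Fact p.Prime] (x : c0 p) : ℚ_[p] :=
  ∑' n, x.1 n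

/-- The operator `F` with parameter `lam`: `(F x)ₙ = λₙ (1 / (1 + ∑ xₙ))²`.
It is meaningful only for `1 + ∑ xₙ ≠ 0`; this is part of the definition of a fixed point below. -/
noncomputable def opF {p : ℕ} [Fact p.Prime] (lam : c0 p) (x : c0 p) : c0 p :=
  ⟨fun n => lam.1 n * (1 / (1 + seriesSum x)) ^ 2, by
    have h : Tendsto lam.1 atTop (𝓝 0) := lam.2
    have h2 := h.mul_const ((1 / (1 + seriesSum x)) ^ 2)
    rw [zero_mul] at h2
    exact h2⟩

/-- The fixed points of `F`: the points of its natural domain that `F` maps to themselves. -/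
def fixF {p : ℕ} [Fact p.Prime] (lam : c0 p) : Set (c0 p) :=
  {x | 1 + seriesSum x ≠ 0 ∧ opF lam x = x}

/-- `x* = x |x|_p = p ^ (- ord_p x) x`, which is a `p`-adic unit for `x ≠ 0` (and `0` for `x = 0`). -/
noncomputable def unitPart {p : ℕ} [Fact p.Prime] (x : ℚ_[p]) : ℚ_[p] :=
  (p : ℚ_[p]) ^ (-x.valuation) * x

theorem norm_unitPart_le {p : ℕ} [Fact p.Prime] (x : ℚ_[p]) : ‖unitPart x‖ ≤ 1 := by
  by_cases hx : x = 0
  · simp [unitPart, hx]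
  · have hp : (p : ℝ) ≠ 0 := by exact_mod_cast (Fact.out : p.Prime).ne_zero
    rw [unitPart, norm_mul, Padic.norm_p_zpow, Padic.norm_eq_zpow_neg_valuation hx,
      ← zpow_add₀ hp]
    simp

/-- The digit `x₀ ∈ {0, …, p - 1}` in the canonical form
`x = p ^ (ord_p x) (x₀ + x₁ p + x₂ p² + ⋯)`, `x₀ ≠ 0`, of `x ≠ 0`. -/
noncomputable def leadingDigit {p : ℕ} [Fact p.Prime] (x : ℚ_[p]) : ℕ :=
  PadicInt.zmodRepr (⟨unitPart x, norm_unitPart_le x⟩ : ℤ_[p])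

/-- The sequence `u₁ = 0`, `u₂ = -a₀`, `u₃ = b₀`, `u_{n+3} = b₀ uₙ - a₀ u_{n+1}` for `n ≥ 1`
(the value at the index `0` is not used). -/
def uSeq (a₀ b₀ : ℤ) : ℕ → ℤ
  | 0 => 0
  | 1 => 0
  | 2 => -a₀
  | 3 => b₀
  | n + 4 => b₀ * uSeq a₀ b₀ (n + 1) - a₀ * uSeq a₀ b₀ (n + 2)

/-- The conditions on `b` under which there are three fixed points.
Here `-1/3 = a₀ + a₁ p + ⋯`, `b |b|_p = b₀ + b₁ p + ⋯`, `D |D|_p = d₀ + d₁ p + ⋯`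
and `u = u_{p-2}`. -/
def ThreeCond (p : ℕ) [Fact p.Prime] (b D : ℚ_[p]) (a₀ b₀ d₀ u : ℤ) : Prop :=
  (1 < ‖b‖ ^ 2 ∧ 3 ∣ b.valuation ∧ p ≡ 1 [MOD 3] ∧ b₀ ^ ((p - 1) / 3) ≡ 1 [ZMOD p]) ∨
  (‖b‖ = 1 ∧ 0 < ‖D‖ ∧ ‖D‖ < 1 ∧ 2 ∣ D.valuation ∧ d₀ ^ ((p - 1) / 2) ≡ 1 [ZMOD p]) ∨
  (‖b‖ = 1 ∧ ‖D‖ = 1 ∧ u ≡ 0 [ZMOD p]) ∨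
  (‖b‖ < 1 ∧ (-a₀) ^ ((p - 1) / 2) ≡ 1 [ZMOD p])

/-- The degenerate condition, with a double root `t` for which `z = t - 2/3 ≠ -1`. -/
def TwoCond (p : ℕ) [Fact p.Prime] (θ b D : ℚ_[p]) : Prop :=
  ‖b‖ = 1 ∧ D = 0 ∧ θ ≠ 0

/-- The conditions under which there is exactly one fixed point; the first is the degenerate case
in which the double root gives `z = -1`, where `F` is not defined. -/
def OneCond (p : ℕ) [Fact p.Prime] (θ b D : ℚ_[p]) (a₀ d₀ D₀ u : ℤ) : Prop :=
  (‖b‖ = 1 ∧ D = 0 ∧ θ = 0) ∨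
  (1 < ‖b‖ ∧ 3 ∣ b.valuation ∧ p ≡ 2 [MOD 3]) ∨
  (‖b‖ = 1 ∧ 0 < ‖D‖ ∧ ‖D‖ < 1 ∧ 2 ∣ D.valuation ∧ ¬ d₀ ^ ((p - 1) / 2) ≡ 1 [ZMOD p]) ∨
  (‖b‖ = 1 ∧ 0 < ‖D‖ ∧ ‖D‖ < 1 ∧ ¬ 2 ∣ D.valuation) ∨
  (‖b‖ = 1 ∧ ¬ D₀ * u ^ 2 ≡ 0 [ZMOD p] ∧ ¬ D₀ * u ^ 2 ≡ 9 * a₀ ^ 2 [ZMOD p]) ∨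
  (‖b‖ < 1 ∧ ¬ (-a₀) ^ ((p - 1) / 2) ≡ 1 [ZMOD p])

/-! A fixed point is determined by S = ∑ xₙ, and summing the fixed point equation gives S(1 + S)² =
θ. With t = S + 2/3 this becomes t³ - t/3 = b, and the forbidden value S = -1 becomes t = -1/3,
which is a root only for θ = 0 (`encard_fixF`). It remains to count the roots of t³ + at = b in ℚ_p.

Once one root is known, the others solve a quadratic whose discriminant agrees with that of the
cubic up to a square. So a nonzero discriminant gives 3 roots or 1, according as it is a square or
not (`encard_cubicRoots_eq_three`, `encard_cubicRoots_eq_one`). For existence, roots of an integral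
cubic are integral and reduce mod p, while simple roots mod p lift by Hensel. If |b| > 1, any root
forces 3 ∣ ord b, and then rescaling leads to r³ = b₀ mod p; if |b| < 1, 0 is a simple root mod p;
if |b| = 1 and |D| < 1, 9b is one.

If |b| = |D| = 1, Frobenius permutes the three distinct roots x, y, z of the reduced cubic in an
algebraically closed extension of 𝔽_p. Since uₙ is the complete homogeneous symmetric polynomial of
degree n in the roots, u_{p-2} times the Vandermonde product V is an expression in xᵖ, yᵖ, zᵖ. It
equals 0 for the identity, 3x(y - z) for the transposition of y and z, and ±3a for a 3-cycle. As V²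
is the discriminant, this separates the three cases (`cubic_zmod_of_root`, `cubic_zmod_of_no_root`).
-/

/-- The roots of the cubic equation `t ^ 3 + a * t = b`. -/
def cubicRoots {K : Type*} [Field K] (a b : K) : Set K := {t | t ^ 3 + a * t = b}

/-! ### Cubics over a field: discriminant and number of roots -/

section Field

variable {K : Type*} [Field K] {a b r : K}

/-- Dividing out the root r leaves a quadratic of discriminant -3r² - 4a; the other factor is the
square of the derivative at r. -/
theorem cubic_discr_eq (hr : r ∈ cubicRoots a b) :
    -4 * a ^ 3 - 27 * b ^ 2 = (-3 * r ^ 2 - 4 * a) * (3 * r ^ 2 + a) ^ 2 := by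
  have h : r ^ 3 + a * r = b := hr
  rw [← h]; ring

theorem encard_cubicRoots_eq_three (h2 : (2 : K) ≠ 0) (hr : r ∈ cubicRoots a b)
    (h0 : -4 * a ^ 3 - 27 * b ^ 2 ≠ 0) (hs : IsSquare (-4 * a ^ 3 - 27 * b ^ 2)) :
    (cubicRoots a b).encard = 3 := by
  have hd := cubic_discr_eq hr
  have hr' : r ^ 3 + a * r = b := hr
  obtain ⟨s, hs⟩ := hs
  have he : 3 * r ^ 2 + a ≠ 0 := by
    rintro h; apply h0; rw [hd, h]; ring
  have hq : -3 * r ^ 2 - 4 * a ≠ 0 := by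
    rintro h; apply h0; rw [hd, h]; ring
  obtain ⟨w, hw⟩ : ∃ w, w ^ 2 = -3 * r ^ 2 - 4 * a := by
    refine ⟨s / (3 * r ^ 2 + a), ?_⟩
    rw [div_pow, div_eq_iff (pow_ne_zero 2 he), ← hd, hs, sq]
  have hw0 : w ≠ 0 := by rintro rfl; apply hq; rw [← hw]; ring
  have h4 : (4 : K) ≠ 0 := by
    have : (4 : K) = 2 * 2 := by norm_num
    rw [this]; exact mul_ne_zero h2 h2
  rw [Set.encard_eq_three]
  refine ⟨r, (-r + w) / 2, (-r - w) / 2, ?_, ?_, ?_, ?_⟩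
  · intro h
    rw [eq_div_iff h2] at h
    have h3 : w = 3 * r := by linear_combination -h
    have : 4 * (3 * r ^ 2 + a) = 0 := by rw [h3] at hw; linear_combination hw
    exact (mul_ne_zero h4 he) this
  · intro h
    rw [eq_div_iff h2] at h
    have h3 : w = -3 * r := by linear_combination h
    have : 4 * (3 * r ^ 2 + a) = 0 := by rw [h3] at hw; linear_combination hw
    exact (mul_ne_zero h4 he) this
  · intro h
    rw [div_left_inj' h2] at h
    have : 2 * w = 0 := by linear_combination h
    exact (mul_ne_zero h2 hw0) this
  · ext t
    have key : 4 * (t ^ 3 + a * t - b) = (t - r) * ((2 * t + r - w) * (2 * t + r + w)) := by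
      rw [← hr']; linear_combination (t - r) * hw
    simp only [cubicRoots, Set.mem_ofPred_eq, Set.mem_insert_iff, Set.mem_singleton_iff]
    rw [← sub_eq_zero, ← mul_right_inj' h4, key, mul_zero, mul_eq_zero, mul_eq_zero,
      eq_div_iff h2, eq_div_iff h2]
    refine or_congr sub_eq_zero (or_congr ?_ ?_)
    · constructor <;> intro h <;> linear_combination h
    · constructor <;> intro h <;> linear_combination h

theorem encard_cubicRoots_eq_one (hr : r ∈ cubicRoots a b)
    (hs : ¬ IsSquare (-4 * a ^ 3 - 27 * b ^ 2)) : (cubicRoots a b).encard = 1 := by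
  rw [Set.encard_eq_one]
  refine ⟨r, Set.Subset.antisymm ?_ (by simpa using hr)⟩
  intro t ht
  have hr' : r ^ 3 + a * r = b := hr
  have ht' : t ^ 3 + a * t = b := ht
  by_contra hne
  have hne : t - r ≠ 0 := sub_ne_zero.mpr hne
  have h : t ^ 2 + r * t + r ^ 2 + a = 0 := by
    apply mul_left_cancel₀ hne
    linear_combination ht' - hr'
  -- A second root t of the quadratic cofactor makes 2t + r a square root of -3r² - 4a.
  refine hs ⟨(2 * t + r) * (3 * r ^ 2 + a), ?_⟩
  rw [cubic_discr_eq hr]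
  linear_combination (-4) * (3 * r ^ 2 + a) ^ 2 * h

theorem encard_cubicRoots_scale {c : K} (hc : c ≠ 0) :
    (cubicRoots (c ^ 2 * a) (c ^ 3 * b)).encard = (cubicRoots a b).encard := by
  have hinj : Function.Injective (fun t : K => c * t) := mul_right_injective₀ hc
  rw [← hinj.injOn.encard_image (s := cubicRoots a b)]
  congr 1
  ext s
  simp only [cubicRoots, Set.mem_ofPred_eq, Set.mem_image]
  constructor
  · intro h
    refine ⟨s / c, ?_, by field_simp⟩
    apply mul_left_cancel₀ (pow_ne_zero 3 hc)
    rw [← h]; field_simp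
  · rintro ⟨t, ht, rfl⟩
    rw [← ht]; ring

end Field

/-! ### From fixed points to roots of a cubic -/

section FixedPoints

variable {p : ℕ} [Fact p.Prime]

theorem seriesSum_opF (lam x : c0 p) :
    seriesSum (opF lam x) = seriesSum lam * (1 / (1 + seriesSum x)) ^ 2 := by
  unfold seriesSum opF
  exact tsum_mul_right

/-- The fixed points of `F` correspond to the roots of a depressed cubic through
`t = 2 / 3 + ∑ xₙ`. -/
theorem encard_fixF (lam : c0 p) :
    (fixF lam).encard =
      {t : ℚ_[p] | t ∈ cubicRoots (-1 / 3) (seriesSum lam + 2 / 27) ∧ t ≠ -1 / 3}.encard := by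
  -- `opF lam x` depends on x only through its sum, so a fixed point is recovered from that sum.
  have hinj : Set.InjOn (fun x : c0 p => seriesSum x + 2 / 3) (fixF lam) := by
    intro x hx y hy hxy
    have h : seriesSum x = seriesSum y := add_right_cancel hxy
    rw [← hx.2, ← hy.2]
    refine Subtype.ext (funext fun n => ?_)
    change lam.1 n * (1 / (1 + seriesSum x)) ^ 2 = lam.1 n * (1 / (1 + seriesSum y)) ^ 2
    rw [h]
  rw [← hinj.encard_image]
  congr 1
  ext t
  simp only [Set.mem_image, Set.mem_ofPred_eq, cubicRoots]
  constructor
  · rintro ⟨x, ⟨h0, hx⟩, rfl⟩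
    have h := seriesSum_opF lam x
    rw [hx, one_div, inv_pow, ← div_eq_mul_inv, eq_div_iff (pow_ne_zero 2 h0)] at h
    refine ⟨by linear_combination h, fun h' => h0 (by linear_combination h')⟩
  · rintro ⟨ht, hne⟩
    have h0 : 1 + (t - 2 / 3) ≠ 0 := fun h => hne (by linear_combination h)
    have hS : seriesSum lam * (1 / (1 + (t - 2 / 3))) ^ 2 = t - 2 / 3 := by
      rw [one_div, inv_pow, ← div_eq_mul_inv, div_eq_iff (pow_ne_zero 2 h0)]
      linear_combination -ht
    let x : c0 p := ⟨fun n => lam.1 n * (1 / (1 + (t - 2 / 3))) ^ 2, by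
      have h : Tendsto lam.1 atTop (𝓝 0) := lam.2
      have h2 := h.mul_const ((1 / (1 + (t - 2 / 3))) ^ 2)
      rw [zero_mul] at h2
      exact h2⟩
    have hx : seriesSum x = t - 2 / 3 := by
      rw [← hS]
      exact tsum_mul_right
    refine ⟨x, ⟨by rwa [hx], ?_⟩, by rw [hx]; ring⟩
    refine Subtype.ext (funext fun n => ?_)
    change lam.1 n * (1 / (1 + seriesSum x)) ^ 2 = lam.1 n * (1 / (1 + (t - 2 / 3))) ^ 2
    rw [hx]

theorem encard_fixF_of_ne_zero {lam : c0 p} (h : seriesSum lam ≠ 0) :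
    (fixF lam).encard = (cubicRoots (-1 / 3) (seriesSum lam + 2 / 27)).encard := by
  rw [encard_fixF]
  congr 1
  ext t
  refine ⟨And.left, fun ht => ⟨ht, ?_⟩⟩
  rintro rfl
  have ht : (-1 / 3 : ℚ_[p]) ^ 3 + (-1 / 3) * (-1 / 3) = seriesSum lam + 2 / 27 := ht
  exact h (by linear_combination -ht)

/-- The cubic is (t - 2/3)(t + 1/3)², and its double root is exactly the excluded point. -/
theorem encard_fixF_of_eq_zero {lam : c0 p} (h : seriesSum lam = 0) : (fixF lam).encard = 1 := by
  rw [encard_fixF, h, Set.encard_eq_one]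
  refine ⟨2 / 3, ?_⟩
  ext t
  have key : t ^ 3 + -1 / 3 * t - (0 + 2 / 27) = (t - 2 / 3) * (t + 1 / 3) ^ 2 := by ring
  simp only [cubicRoots, Set.mem_ofPred_eq, Set.mem_singleton_iff]
  constructor
  · rintro ⟨h1, h2⟩
    rw [h1, sub_self, eq_comm, mul_eq_zero] at key
    rcases key with h | h
    · linear_combination h
    · exact absurd (by linear_combination pow_eq_zero_iff two_ne_zero |>.mp h) h2
  · rintro rfl
    exact ⟨by norm_num, by norm_num⟩

theorem encard_cubicRoots_of_eq_neg :
    (cubicRoots (-1 / 3 : ℚ_[p]) (-2 / 27)).encard = 2 := by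
  rw [Set.encard_eq_two]
  refine ⟨1 / 3, -2 / 3, by norm_num, ?_⟩
  ext t
  have key : t ^ 3 + -1 / 3 * t - (-2 / 27) = (t - 1 / 3) ^ 2 * (t - -2 / 3) := by ring
  simp only [cubicRoots, Set.mem_ofPred_eq, Set.mem_singleton_iff, Set.mem_insert_iff]
  rw [← sub_eq_zero, key, mul_eq_zero, pow_eq_zero_iff two_ne_zero, sub_eq_zero, sub_eq_zero]

end FixedPoints

/-! ### Cubics, cubes and squares over 𝔽_p -/

section FiniteField

variable {p : ℕ} [Fact p.Prime]

theorem natCast_zmod_ne_zero_of_lt {n : ℕ} (h0 : 0 < n) (h : n < p) : (n : ZMod p) ≠ 0 := by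
  rw [Ne, ZMod.natCast_eq_zero_iff]
  exact Nat.not_dvd_of_pos_of_lt h0 h

theorem two_ne_zero_zmod (hp : 3 < p) : (2 : ZMod p) ≠ 0 := by
  exact_mod_cast natCast_zmod_ne_zero_of_lt (n := 2) (by omega) (by omega)

theorem three_ne_zero_zmod (hp : 3 < p) : (3 : ZMod p) ≠ 0 := by
  exact_mod_cast natCast_zmod_ne_zero_of_lt (n := 3) (by omega) hp

/-- The p elements of 𝔽_p already exhaust the roots of Xᵖ - X, so membership in 𝔽_p can be tested by
Frobenius. -/
theorem exists_algebraMap_eq_of_pow_eq {L : Type*} [Field L] [Algebra (ZMod p) L] {x : L}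
    (hx : x ^ p = x) : ∃ y : ZMod p, algebraMap (ZMod p) L y = x := by
  classical
  by_contra! hne
  have hp : 1 < p := (Fact.out : p.Prime).one_lt
  have hP : (Polynomial.X ^ p - Polynomial.X : Polynomial L) ≠ 0 :=
    FiniteField.X_pow_card_sub_X_ne_zero L hp
  have hsub : insert x (Finset.univ.image (algebraMap (ZMod p) L)) ⊆
      (Polynomial.X ^ p - Polynomial.X : Polynomial L).roots.toFinset := by
    intro z hz
    rw [Multiset.mem_toFinset, Polynomial.mem_roots hP]
    rcases Finset.mem_insert.mp hz with rfl | hz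
    · simp [hx]
    · obtain ⟨y, -, rfl⟩ := Finset.mem_image.mp hz
      simp [← map_pow, ZMod.pow_card]
  have h1 := Finset.card_le_card hsub
  rw [Finset.card_insert_of_notMem (by simpa using hne),
    Finset.card_image_of_injective _ (algebraMap (ZMod p) L).injective, Finset.card_univ,
    ZMod.card] at h1
  have h2 := (Multiset.toFinset_card_le _).trans
    (Polynomial.card_roots' (Polynomial.X ^ p - Polynomial.X : Polynomial L))
  rw [FiniteField.X_pow_card_sub_X_natDegree_eq L hp] at h2
  omega

/-- `uSeq` gives the complete homogeneous symmetric polynomials of the roots of the cubic. -/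
theorem uSeq_mul_vandermonde {L : Type*} [CommRing L] {a b : ℤ} {x y z : L} (h1 : x + y + z = 0)
    (h2 : x * y + y * z + z * x = a) (h3 : x * y * z = b) (n : ℕ) :
    (uSeq a b (n + 1) : L) * ((x - y) * (y - z) * (x - z)) =
      x ^ (n + 3) * (y - z) - y ^ (n + 3) * (x - z) + z ^ (n + 3) * (x - y) := by
  have hz : z = -x - y := by linear_combination h1
  have hx : x ^ 3 = b - a * x := by rw [← h2, ← h3, hz]; ring
  have hy : y ^ 3 = b - a * y := by rw [← h2, ← h3, hz]; ring
  have hz' : z ^ 3 = b - a * z := by rw [← h2, ← h3, hz]; ring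
  induction n using Nat.strong_induction_on with
  | _ n ih =>
    match n with
    | 0 => simp only [uSeq]; rw [hz]; push_cast; ring
    | 1 => simp only [uSeq]; push_cast; rw [← h2, hz]; ring
    | 2 => simp only [uSeq]; rw [← h3, hz]; ring
    -- Each root satisfies x^(k+3) = b x^k - a x^(k+1), the recurrence of `uSeq`.
    | n + 3 =>
      have e1 := ih n (by omega)
      have e2 := ih (n + 1) (by omega)
      rw [uSeq]
      push_cast
      linear_combination b * e1 - a * e2 - x ^ (n + 3) * (y - z) * hx +
        y ^ (n + 3) * (x - z) * hy - z ^ (n + 3) * (x - y) * hz'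

/-- The formula for (y - z)² is kept because it lies in the base field when x does, so that
Frobenius can only change the sign of y - z. -/
theorem exists_cubic_roots {L : Type*} [Field L] [IsAlgClosed L] (h2 : (2 : L) ≠ 0) {a b x : L}
    (hx : x ^ 3 + a * x = b) :
    ∃ y z : L, x + y + z = 0 ∧ x * y + y * z + z * x = a ∧ x * y * z = b ∧
      (y - z) ^ 2 = -3 * x ^ 2 - 4 * a := by
  obtain ⟨w, hw⟩ := IsAlgClosed.exists_pow_nat_eq (-3 * x ^ 2 - 4 * a) two_pos
  have ha : a = -(w ^ 2 + 3 * x ^ 2) / 4 := by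
    have : (4 : L) ≠ 0 := by
      have : (4 : L) = 2 * 2 := by norm_num
      rw [this]; exact mul_ne_zero h2 h2
    rw [eq_div_iff this, hw]; ring
  refine ⟨(-x + w) / 2, (-x - w) / 2, by field_simp; ring, ?_, ?_, ?_⟩
  · rw [ha]
    have : (4 : L) = 2 * 2 := by norm_num
    rw [this]; field_simp; ring
  · rw [← hx, ha]
    have : (4 : L) = 2 * 2 := by norm_num
    rw [this]; field_simp; ring
  · rw [← hw]; field_simp; ring

theorem exists_root_cubic {L : Type*} [Field L] [IsAlgClosed L] (a b : L) :
    ∃ x : L, x ^ 3 + a * x = b := by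
  obtain ⟨x, hx⟩ := IsAlgClosed.exists_root
    (Polynomial.X ^ 3 + Polynomial.C a * Polynomial.X - Polynomial.C b : Polynomial L) (by
      have : (Polynomial.X ^ 3 + Polynomial.C a * Polynomial.X - Polynomial.C b :
        Polynomial L).degree = 3 := by compute_degree!
      rw [this]; norm_num)
  refine ⟨x, ?_⟩
  simpa [sub_eq_zero] using hx

theorem cubic_mem_of_root {L : Type*} [Field L] {a b x y z t : L} (h1 : x + y + z = 0)
    (h2 : x * y + y * z + z * x = a) (h3 : x * y * z = b) (ht : t ^ 3 + a * t = b) :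
    t = x ∨ t = y ∨ t = z := by
  have : (t - x) * ((t - y) * (t - z)) = 0 := by
    linear_combination ht - t ^ 2 * h1 + t * h2 - h3
  rcases mul_eq_zero.mp this with h | h
  · exact Or.inl (sub_eq_zero.mp h)
  · rcases mul_eq_zero.mp h with h | h
    · exact Or.inr (Or.inl (sub_eq_zero.mp h))
    · exact Or.inr (Or.inr (sub_eq_zero.mp h))

theorem cubic_pow_root {L : Type*} [Field L] [CharP L p] {a b : ℤ} {x : L}
    (hx : x ^ 3 + a * x = b) : (x ^ p) ^ 3 + a * x ^ p = b := by
  have h := congrArg (frobenius L p) hx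
  rw [map_add, map_mul, map_pow, map_intCast, map_intCast] at h
  exact h

theorem discr_eq_vandermonde_sq {L : Type*} [CommRing L] {a b x y z : L} (h1 : x + y + z = 0)
    (h2 : x * y + y * z + z * x = a) (h3 : x * y * z = b) :
    -4 * a ^ 3 - 27 * b ^ 2 = ((x - y) * (y - z) * (x - z)) ^ 2 := by
  have hz : z = -x - y := by linear_combination h1
  rw [← h2, ← h3, hz]; ring

/-- Criterion for the solvability of a cubic congruence when it has a root. -/
theorem cubic_zmod_of_root (hp : 3 < p) {a b : ℤ} (hb : (b : ZMod p) ≠ 0)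
    (hd : (-4 * a ^ 3 - 27 * b ^ 2 : ZMod p) ≠ 0) {r : ZMod p} (hr : r ^ 3 + a * r = b) :
    (IsSquare (-4 * a ^ 3 - 27 * b ^ 2 : ZMod p) ∧ (uSeq a b (p - 2) : ZMod p) = 0) ∨
    (¬ IsSquare (-4 * a ^ 3 - 27 * b ^ 2 : ZMod p) ∧ (uSeq a b (p - 2) : ZMod p) ≠ 0 ∧
      (-4 * a ^ 3 - 27 * b ^ 2 : ZMod p) * (uSeq a b (p - 2) : ZMod p) ^ 2 ≠ 9 * a ^ 2) := by
  obtain ⟨L, _, _, _⟩ : ∃ (L : Type) (_ : Field L) (_ : Algebra (ZMod p) L), IsAlgClosed L :=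
    ⟨AlgebraicClosure (ZMod p), inferInstance, inferInstance, inferInstance⟩
  let ι := algebraMap (ZMod p) L
  have hι : Function.Injective ι := ι.injective
  have : CharP L p := charP_of_injective_algebraMap hι p
  have h2 : (2 : ZMod p) ≠ 0 := two_ne_zero_zmod hp
  have h3' : (3 : ZMod p) ≠ 0 := three_ne_zero_zmod hp
  have h3L : (3 : L) ≠ 0 := by
    rw [← map_ofNat ι 3]; exact (map_ne_zero ι).mpr h3'
  have h2L : (2 : L) ≠ 0 := by
    rw [← map_ofNat ι 2]; exact (map_ne_zero ι).mpr h2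
  have hx : (ι r) ^ 3 + (a : L) * ι r = b := by
    have := congrArg ι hr
    simpa using this
  have hxp : ι r ^ p = ι r := by rw [← map_pow, ZMod.pow_card]
  obtain ⟨y, z, e1, e2, e3, e4⟩ := exists_cubic_roots h2L hx
  set x := ι r with hxdef
  have hdisc := discr_eq_vandermonde_sq e1 e2 e3
  have hdL : (-4 * (a : L) ^ 3 - 27 * (b : L) ^ 2) ≠ 0 := by
    have := (map_ne_zero ι).mpr hd
    simpa only [map_mul, map_pow, map_sub, map_neg, map_ofNat, map_intCast] using this
  have hV : (x - y) * (y - z) * (x - z) ≠ 0 := by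
    intro h; apply hdL; rw [hdisc, h]; ring
  have hU := uSeq_mul_vandermonde e1 e2 e3 (p - 3)
  have hp1 : p - 3 + 1 = p - 2 := by omega
  have hp2 : p - 3 + 3 = p := by omega
  rw [hp1, hp2, hxp] at hU
  have hw : (y - z) ^ p = y ^ p - z ^ p := sub_pow_char y z
  have hyz : y ^ p + z ^ p = y + z := by
    rw [← add_pow_char y z]
    have : y + z = - x := by linear_combination e1
    rw [this, hxdef, ← map_neg, ← map_pow, ZMod.pow_card]
  have hq : ((y - z) ^ p) ^ 2 = (y - z) ^ 2 := by
    have : (y - z) ^ 2 = ι (-3 * r ^ 2 - 4 * a) := by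
      rw [e4]; simp only [hxdef, map_mul, map_pow, map_sub, map_neg, map_ofNat, map_intCast]
    rw [← pow_mul, mul_comm, pow_mul, this, ← map_pow, ZMod.pow_card]
  -- Frobenius fixes x and y + z; the sign here tells whether it fixes y and z or swaps them.
  rcases sq_eq_sq_iff_eq_or_eq_neg.mp hq with h | h
  · left
    have hy : y ^ p = y := by
      apply mul_left_cancel₀ h2L; linear_combination hyz + h - hw
    have hz : z ^ p = z := by linear_combination hyz - hy
    constructor
    · obtain ⟨s, hs⟩ := exists_algebraMap_eq_of_pow_eq h
      refine ⟨s * (3 * r ^ 2 + a), hι ?_⟩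
      have e5 := cubic_discr_eq (r := r) hr
      rw [e5]
      have hs' : ι s = y - z := hs
      simp only [map_mul, map_pow, map_add, map_sub, map_neg, map_ofNat, map_intCast, hs']
      linear_combination (3 * x ^ 2 + a) ^ 2 * (-e4)
    · apply hι
      rw [map_intCast, map_zero]
      refine (mul_eq_zero.mp ?_).resolve_right hV
      rw [hU, hy, hz]; ring
  · right
    have hy : y ^ p = z := by
      apply mul_left_cancel₀ h2L; linear_combination hyz + h - hw
    have hz : z ^ p = y := by linear_combination hyz - hy
    rw [hy, hz] at hU
    have hyz0 : y - z ≠ 0 := by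
      intro h; apply hV; rw [h]; ring
    have hx0 : x ≠ 0 := by
      intro h
      apply hb; apply hι
      rw [map_intCast, map_zero, ← e3, h]; ring
    have hU' : (uSeq a b (p - 2) : L) * ((x - y) * (x - z)) = 3 * x := by
      apply mul_right_cancel₀ hyz0
      have : x = -y - z := by linear_combination e1
      rw [this] at hU ⊢
      linear_combination hU
    refine ⟨?_, ?_, ?_⟩
    -- A square discriminant would put the Vandermonde product in 𝔽_p, but the transposition changes
    -- its sign.
    · rintro ⟨s, hs⟩
      have e5 : ((x - y) * (y - z) * (x - z)) ^ 2 = (ι s) ^ 2 := by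
        rw [← hdisc, ← map_pow, sq s, ← hs]
        simp only [map_mul, map_pow, map_sub, map_neg, map_ofNat, map_intCast]
      have e6 : ((x - y) * (y - z) * (x - z)) ^ p = (x - y) * (y - z) * (x - z) := by
        rcases sq_eq_sq_iff_eq_or_eq_neg.mp e5 with h | h
        · rw [h, ← map_pow, ZMod.pow_card]
        · rw [h, ← map_neg, ← map_pow, ZMod.pow_card]
      rw [mul_pow, mul_pow, sub_pow_char, sub_pow_char, sub_pow_char, hxp, hy, hz] at e6
      have : 2 * ((x - y) * (y - z) * (x - z)) = 0 := by linear_combination -e6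
      exact mul_ne_zero h2L hV this
    · intro h
      have hL : (uSeq a b (p - 2) : L) = 0 := by
        rw [← map_intCast ι, h, map_zero]
      rw [hL, zero_mul] at hU'
      exact mul_ne_zero h3L hx0 hU'.symm
    · intro h
      have hL := congrArg ι h
      simp only [map_mul, map_pow, map_sub, map_neg, map_ofNat, map_intCast] at hL
      rw [hdisc] at hL
      have h9 : (9 : L) ≠ 0 := by
        have : (9 : L) = 3 * 3 := by norm_num
        rw [this]; exact mul_ne_zero h3L h3L
      -- Equality with 9a² would mean 9x²(-3x² - 4a) = 9a², which factors; the first factor would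
      -- kill the discriminant, the second b.
      have e7 : 9 * ((3 * x ^ 2 + a) * (x ^ 2 + a)) = 0 := by
        have e8 : ((x - y) * (y - z) * (x - z)) ^ 2 * (uSeq a b (p - 2) : L) ^ 2 =
            9 * x ^ 2 * (y - z) ^ 2 := by
          linear_combination ((y - z) ^ 2) *
            ((uSeq a b (p - 2) : L) * ((x - y) * (x - z)) + 3 * x) * hU'
        rw [e8, e4] at hL
        linear_combination -hL
      rcases mul_eq_zero.mp ((mul_eq_zero.mp e7).resolve_left h9) with h | h
      · apply hdL
        rw [cubic_discr_eq (r := x) hx, h]; ring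
      · apply hb; apply hι
        rw [map_intCast, map_zero, ← hx]
        linear_combination x * h

/-- Without a root in 𝔽_p, Frobenius fixes none of the three roots, hence acts as a 3-cycle. -/
theorem cubic_zmod_of_no_root (hp : 3 < p) {a b : ℤ} (ha : (a : ZMod p) ≠ 0)
    (hd : (-4 * a ^ 3 - 27 * b ^ 2 : ZMod p) ≠ 0) (hr : ¬ ∃ r : ZMod p, r ^ 3 + a * r = b) :
    (uSeq a b (p - 2) : ZMod p) ≠ 0 ∧
      (-4 * a ^ 3 - 27 * b ^ 2 : ZMod p) * (uSeq a b (p - 2) : ZMod p) ^ 2 = 9 * a ^ 2 := by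
  obtain ⟨L, _, _, _⟩ : ∃ (L : Type) (_ : Field L) (_ : Algebra (ZMod p) L), IsAlgClosed L :=
    ⟨AlgebraicClosure (ZMod p), inferInstance, inferInstance, inferInstance⟩
  let ι := algebraMap (ZMod p) L
  have hι : Function.Injective ι := ι.injective
  have : CharP L p := charP_of_injective_algebraMap hι p
  have h2 : (2 : ZMod p) ≠ 0 := two_ne_zero_zmod hp
  have h3' : (3 : ZMod p) ≠ 0 := three_ne_zero_zmod hp
  have h2L : (2 : L) ≠ 0 := by
    rw [← map_ofNat ι 2]; exact (map_ne_zero ι).mpr h2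
  have hfix : ∀ t : L, t ^ 3 + a * t = b → t ^ p ≠ t := by
    intro t ht htp
    obtain ⟨s, rfl⟩ := exists_algebraMap_eq_of_pow_eq htp
    exact hr ⟨s, hι (by simpa [ι] using ht)⟩
  have hinj : ∀ s t : L, s ^ p = t ^ p → s = t := fun s t h => frobenius_inj L p h
  obtain ⟨x, hx⟩ := exists_root_cubic (a : L) b
  obtain ⟨y, z, e1, e2, e3, -⟩ := exists_cubic_roots h2L hx
  have hz' : z = -x - y := by linear_combination e1
  have hy : y ^ 3 + a * y = b := by rw [← e2, ← e3, hz']; ring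
  have hz : z ^ 3 + a * z = b := by rw [← e2, ← e3, hz']; ring
  have hdisc := discr_eq_vandermonde_sq e1 e2 e3
  have hU := uSeq_mul_vandermonde e1 e2 e3 (p - 3)
  have hp1 : p - 3 + 1 = p - 2 := by omega
  have hp2 : p - 3 + 3 = p := by omega
  rw [hp1, hp2] at hU
  have mx := (cubic_mem_of_root e1 e2 e3 (cubic_pow_root (p := p) hx)).resolve_left (hfix x hx)
  have my := cubic_mem_of_root e1 e2 e3 (cubic_pow_root (p := p) hy)
  have mz := cubic_mem_of_root e1 e2 e3 (cubic_pow_root (p := p) hz)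
  have fy := hfix y hy
  have fz := hfix z hz
  have hU2 : ((uSeq a b (p - 2) : L) * ((x - y) * (y - z) * (x - z))) ^ 2 = 9 * (a : L) ^ 2 := by
    have hV0 : (x - y) * (y - z) * (x - z) ≠ 0 := by
      intro h
      apply hd; apply hι
      rw [map_zero]
      simp only [map_mul, map_pow, map_sub, map_neg, map_ofNat, map_intCast]
      rw [hdisc, h]; ring
    have hxy : x ≠ y := by rintro rfl; apply hV0; ring
    have hyz : y ≠ z := by rintro rfl; apply hV0; ring
    have hxz : x ≠ z := by rintro rfl; apply hV0; ring
    rw [hU]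
    -- The two 3-cycles give ±(x² + y² + z² - xy - yz - zx) = ∓3a, by x + y + z = 0.
    rcases mx with h | h
    · have hyp : y ^ p = z := by
        rcases my with h' | h' | h'
        · rcases mz with h'' | h'' | h''
          · exact absurd (hinj _ _ (h'.trans h''.symm)) hyz
          · exact absurd (hinj _ _ (h.trans h''.symm)) hxz
          · exact absurd h'' fz
        · exact absurd h' fy
        · exact h'
      have hzp : z ^ p = x := by
        rcases mz with h'' | h'' | h''
        · exact h''
        · exact absurd (hinj _ _ (h.trans h''.symm)) hxz
        · exact absurd h'' fz
      rw [h, hyp, hzp, ← e2, hz']; ring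
    · have hzp : z ^ p = y := by
        rcases mz with h' | h' | h'
        · rcases my with h'' | h'' | h''
          · exact absurd (hinj _ _ (h''.trans h'.symm)) hyz
          · exact absurd h'' fy
          · exact absurd (hinj _ _ (h.trans h''.symm)) hxy
        · exact h'
        · exact absurd h' fz
      have hyp : y ^ p = x := by
        rcases my with h'' | h'' | h''
        · exact h''
        · exact absurd h'' fy
        · exact absurd (hinj _ _ (h.trans h''.symm)) hxy
      rw [h, hyp, hzp, ← e2, hz']; ring
  have key : (-4 * a ^ 3 - 27 * b ^ 2 : ZMod p) * (uSeq a b (p - 2) : ZMod p) ^ 2 = 9 * a ^ 2 := by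
    apply hι
    simp only [map_mul, map_pow, map_sub, map_neg, map_ofNat, map_intCast]
    rw [hdisc, ← hU2]; ring
  refine ⟨fun h => ?_, key⟩
  rw [h] at key
  have h9 : (9 : ZMod p) ≠ 0 := by
    have : (9 : ZMod p) = 3 * 3 := by norm_num
    rw [this]; exact mul_ne_zero h3' h3'
  exact mul_ne_zero h9 (pow_ne_zero 2 ha) (by rw [← key]; ring)

theorem exists_cube_eq_of_mod_three_eq_two (hp : p % 3 = 2) (c : ZMod p) : ∃ r, r ^ 3 = c := by
  by_cases hc : c = 0
  · exact ⟨0, by simp [hc]⟩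
  · refine ⟨c ^ ((2 * p - 1) / 3), ?_⟩
    rw [← pow_mul]
    have : (2 * p - 1) / 3 * 3 = (p - 1) + (p - 1) + 1 := by omega
    rw [this, pow_add, pow_add, ZMod.pow_card_sub_one_eq_one hc]; ring

theorem exists_cube_eq_iff (hp : p % 3 = 1) {c : ZMod p} (hc : c ≠ 0) :
    (∃ r, r ^ 3 = c) ↔ c ^ ((p - 1) / 3) = 1 := by
  have hp3 : 3 * ((p - 1) / 3) = p - 1 := by omega
  have hpos : 0 < (p - 1) / 3 := by
    have := (Fact.out : p.Prime).two_le; omega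
  constructor
  · rintro ⟨r, rfl⟩
    rw [← pow_mul, hp3]
    exact ZMod.pow_card_sub_one_eq_one (by rintro rfl; simp at hc)
  · intro h
    obtain ⟨g, hg⟩ := IsCyclic.exists_generator (α := (ZMod p)ˣ)
    obtain ⟨k, hk⟩ := (Subgroup.mem_zpowers_iff).mp (hg (Units.mk0 c hc))
    have h1 : g ^ (k * ((p - 1) / 3 : ℕ)) = 1 := by
      rw [zpow_mul, hk, zpow_natCast]
      ext; simpa using h
    have ho : orderOf g = 3 * ((p - 1) / 3) := by
      rw [hp3, orderOf_eq_card_of_forall_mem_zpowers hg, Nat.card_eq_fintype_card, ZMod.card_units]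
    rw [← orderOf_dvd_iff_zpow_eq_one, ho] at h1
    push_cast at h1
    -- With c = gᵏ and g of order p - 1, the hypothesis says that p - 1 divides k(p - 1)/3.
    obtain ⟨m, rfl⟩ : (3 : ℤ) ∣ k := by
      refine Int.dvd_of_mul_dvd_mul_right (a := (((p - 1) / 3 : ℕ) : ℤ)) ?_ ?_
      · exact_mod_cast hpos.ne'
      · exact_mod_cast h1
    refine ⟨((g ^ m : (ZMod p)ˣ) : ZMod p), ?_⟩
    have := congrArg (Units.val) hk
    rw [Units.val_mk0] at this
    rw [← this, ← Units.val_pow_eq_pow_val, mul_comm 3 m, zpow_mul]; rfl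

/-- Square roots s of -3 correspond to primitive cube roots of unity (s - 1)/2, which exist exactly
when 3 divides p - 1. -/
theorem isSquare_neg_three_iff (hp : 3 < p) : IsSquare (-3 : ZMod p) ↔ p % 3 = 1 := by
  have h2 : (2 : ZMod p) ≠ 0 := two_ne_zero_zmod hp
  have h3 : (3 : ZMod p) ≠ 0 := three_ne_zero_zmod hp
  constructor
  · rintro ⟨s, hs⟩
    have hw : ((s - 1) / 2) ^ 3 = 1 := by
      field_simp; linear_combination (s - 3) * (-hs)
    have hw1 : (s - 1) / 2 ≠ 1 := by
      intro h
      rw [div_eq_iff h2] at h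
      have : s = 3 := by linear_combination h
      rw [this] at hs
      have : (2 : ZMod p) * 2 * 3 = 0 := by linear_combination -hs
      exact mul_ne_zero (mul_ne_zero h2 h2) h3 this
    have h0 : (s - 1) / 2 ≠ 0 := by intro h; rw [h] at hw; simp at hw
    have ho := orderOf_eq_prime hw hw1
    have hd : 3 ∣ p - 1 := by
      rw [← ho]; exact orderOf_dvd_of_pow_eq_one (ZMod.pow_card_sub_one_eq_one h0)
    omega
  · intro h
    have hd : 3 ∣ Nat.card (ZMod p)ˣ := by
      rw [Nat.card_eq_fintype_card, ZMod.card_units]; omega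
    have : Fact (Nat.Prime 3) := ⟨Nat.prime_three⟩
    obtain ⟨w, hw⟩ := exists_prime_orderOf_dvd_card' 3 hd
    have hw3 : (w : ZMod p) ^ 3 = 1 := by
      rw [← Units.val_pow_eq_pow_val, ← hw, pow_orderOf_eq_one]; rfl
    have hw1 : (w : ZMod p) - 1 ≠ 0 := by
      intro h
      have : w = 1 := by ext; simpa [sub_eq_zero] using h
      rw [this] at hw; simp at hw
    have hq : (w : ZMod p) ^ 2 + w + 1 = 0 := by
      apply mul_left_cancel₀ hw1; linear_combination hw3
    exact ⟨2 * w + 1, by linear_combination -4 * hq⟩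

theorem isSquare_zmod_iff_pow_modEq (hp : 3 < p) {d : ℤ} (hd : (d : ZMod p) ≠ 0) :
    IsSquare (d : ZMod p) ↔ d ^ ((p - 1) / 2) ≡ 1 [ZMOD p] := by
  have hodd := (Fact.out : p.Prime).eq_two_or_odd
  have : (p - 1) / 2 = p / 2 := by omega
  rw [this, ZMod.euler_criterion p hd, ← ZMod.intCast_eq_intCast_iff]
  push_cast; rfl

end FiniteField

/-! ### Hensel lifting, leading digits and reduction mod p -/

section Padic

variable {p : ℕ} [Fact p.Prime]

theorem toZMod_eq_zero_iff (x : ℤ_[p]) : PadicInt.toZMod x = 0 ↔ ‖x‖ < 1 := by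
  rw [← RingHom.mem_ker, PadicInt.ker_toZMod, IsLocalRing.mem_maximalIdeal,
    PadicInt.mem_nonunits]

theorem exists_root_of_toZMod (F : Polynomial ℤ_[p]) (a : ℤ_[p])
    (h0 : PadicInt.toZMod (F.eval a) = 0) (h1 : PadicInt.toZMod (F.derivative.eval a) ≠ 0) :
    ∃ z, F.eval z = 0 := by
  have h1' : ‖F.derivative.eval a‖ = 1 :=
    le_antisymm (PadicInt.norm_le_one _) (not_lt.mp fun h => h1 ((toZMod_eq_zero_iff _).mpr h))
  have h0' := (toZMod_eq_zero_iff _).mp h0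
  obtain ⟨z, hz, -⟩ := hensels_lemma (F := F) (a := a) (by
    simpa [Polynomial.coe_aeval_eq_eval, h1'] using h0')
  exact ⟨z, by simpa [Polynomial.coe_aeval_eq_eval] using hz⟩

theorem exists_cubic_root_of_toZMod (A B : ℤ_[p]) {r : ZMod p}
    (hr : r ^ 3 + PadicInt.toZMod A * r = PadicInt.toZMod B)
    (h : 3 * r ^ 2 + PadicInt.toZMod A ≠ 0) : ∃ z : ℤ_[p], z ^ 3 + A * z = B := by
  obtain ⟨s, rfl⟩ := ZMod.ringHom_surjective (PadicInt.toZMod (p := p)) r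
  obtain ⟨z, hz⟩ := exists_root_of_toZMod
    (Polynomial.X ^ 3 + Polynomial.C A * Polynomial.X - Polynomial.C B) s
    (by simp [hr]) (by
      simpa only [Polynomial.derivative_sub, Polynomial.derivative_add, Polynomial.derivative_X_pow,
        Polynomial.derivative_C_mul, Polynomial.derivative_X, Polynomial.derivative_C,
        Polynomial.eval_sub, Polynomial.eval_add, Polynomial.eval_mul, Polynomial.eval_pow,
        Polynomial.eval_X, Polynomial.eval_C, Polynomial.eval_one, Polynomial.eval_zero,
        map_add, map_mul, map_pow, map_natCast, map_one, mul_one, sub_zero, Nat.cast_ofNat,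
        map_ofNat, Polynomial.eval_ofNat, Nat.reduceSub] using h)
  exact ⟨z, by simpa [sub_eq_zero] using hz⟩

theorem isSquare_iff_isSquare_toZMod (hp : 3 < p) {A : ℤ_[p]} (hA : PadicInt.toZMod A ≠ 0) :
    IsSquare A ↔ IsSquare (PadicInt.toZMod A) := by
  refine ⟨fun h => h.map _, ?_⟩
  rintro ⟨r, hr⟩
  obtain ⟨s, rfl⟩ := ZMod.ringHom_surjective (PadicInt.toZMod (p := p)) r
  have h2 : (2 : ZMod p) ≠ 0 := two_ne_zero_zmod hp
  have hs : PadicInt.toZMod s ≠ 0 := by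
    intro h; rw [h] at hr; exact hA (by simpa using hr)
  obtain ⟨z, hz⟩ := exists_root_of_toZMod (Polynomial.X ^ 2 - Polynomial.C A) s
    (by simp [hr, sq]) (by
      have : PadicInt.toZMod (2 * s) ≠ 0 := by
        rw [map_mul, map_ofNat]; exact mul_ne_zero h2 hs
      simpa [one_add_one_eq_two] using this)
  exact ⟨z, by simpa [sub_eq_zero, sq, eq_comm] using hz⟩

/-- `unitPart x` as a `p`-adic integer. -/
noncomputable def unitPartInt (x : ℚ_[p]) : ℤ_[p] := ⟨unitPart x, norm_unitPart_le x⟩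

theorem coe_unitPartInt (x : ℚ_[p]) : (unitPartInt x : ℚ_[p]) = unitPart x := rfl

theorem natCast_leadingDigit (x : ℚ_[p]) :
    (leadingDigit x : ZMod p) = PadicInt.toZMod (unitPartInt x) := rfl

theorem unitPart_mul {x y : ℚ_[p]} (hx : x ≠ 0) (hy : y ≠ 0) :
    unitPart (x * y) = unitPart x * unitPart y := by
  have hp : (p : ℚ_[p]) ≠ 0 := by exact_mod_cast (Fact.out : p.Prime).ne_zero
  unfold unitPart
  rw [Padic.valuation_mul hx hy, neg_add, zpow_add₀ hp]; ring

theorem norm_unitPart {x : ℚ_[p]} (hx : x ≠ 0) : ‖unitPart x‖ = 1 := by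
  have hp : (p : ℝ) ≠ 0 := by exact_mod_cast (Fact.out : p.Prime).ne_zero
  rw [unitPart, norm_mul, Padic.norm_p_zpow, Padic.norm_eq_zpow_neg_valuation hx,
    ← zpow_add₀ hp]
  simp

theorem unitPart_of_norm_eq_one {x : ℚ_[p]} (hx : ‖x‖ = 1) : unitPart x = x := by
  have h0 : x ≠ 0 := by rintro rfl; simp at hx
  have h1 : (1 : ℝ) < p := by exact_mod_cast (Fact.out : p.Prime).one_lt
  rw [Padic.norm_eq_zpow_neg_valuation h0, zpow_eq_one_iff_right₀ (by positivity) h1.ne'] at hx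
  rw [unitPart, hx]; simp

theorem natCast_leadingDigit_ne_zero {x : ℚ_[p]} (hx : x ≠ 0) :
    (leadingDigit x : ZMod p) ≠ 0 := by
  rw [natCast_leadingDigit, Ne, toZMod_eq_zero_iff, PadicInt.norm_def,
    coe_unitPartInt, norm_unitPart hx]
  exact lt_irrefl 1

theorem natCast_leadingDigit_of_norm_eq_one {x : ℤ_[p]} (hx : ‖x‖ = 1) :
    (leadingDigit (x : ℚ_[p]) : ZMod p) = PadicInt.toZMod x := by
  rw [natCast_leadingDigit]
  congr 1
  exact PadicInt.ext (unitPart_of_norm_eq_one hx)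

/-- The even power of p is split off, and a unit is a square exactly when its residue is, by Hensel
for odd p. -/
theorem padic_isSquare_iff (hp : 3 < p) {x : ℚ_[p]} (hx : x ≠ 0) :
    IsSquare x ↔ 2 ∣ x.valuation ∧ IsSquare (leadingDigit x : ZMod p) := by
  have hp0 : (p : ℚ_[p]) ≠ 0 := by exact_mod_cast (Fact.out : p.Prime).ne_zero
  constructor
  · rintro ⟨y, rfl⟩
    have hy : y ≠ 0 := by rintro rfl; simp at hx
    refine ⟨⟨y.valuation, by rw [Padic.valuation_mul hy hy]; ring⟩, ?_⟩
    refine ⟨(leadingDigit y : ZMod p), ?_⟩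
    rw [natCast_leadingDigit, natCast_leadingDigit, ← map_mul]
    congr 1
    refine PadicInt.ext ?_
    rw [PadicInt.coe_mul]
    exact unitPart_mul hy hy
  · rintro ⟨⟨k, hk⟩, hs⟩
    have h0 := natCast_leadingDigit_ne_zero hx
    rw [natCast_leadingDigit] at hs h0
    obtain ⟨w, hw⟩ := (isSquare_iff_isSquare_toZMod hp h0).mpr hs
    have hw' : unitPart x = w * w := congrArg (Subtype.val) hw
    refine ⟨(p : ℚ_[p]) ^ k * w, ?_⟩
    have : x = (p : ℚ_[p]) ^ x.valuation * unitPart x := by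
      rw [unitPart, ← mul_assoc, ← zpow_add₀ hp0]; simp
    rw [this, hw', hk, two_mul, zpow_add₀ hp0]; ring

theorem padic_coe_isSquare_iff (hp : 3 < p) {x : ℤ_[p]} (hx : PadicInt.toZMod x ≠ 0) :
    IsSquare (x : ℚ_[p]) ↔ IsSquare (PadicInt.toZMod x) := by
  have h1 : ‖x‖ = 1 :=
    le_antisymm (PadicInt.norm_le_one _) (not_lt.mp fun h => hx ((toZMod_eq_zero_iff _).mpr h))
  constructor
  · intro h
    have h0 : (x : ℚ_[p]) ≠ 0 := by
      rintro h0; rw [PadicInt.norm_def, h0] at h1; simp at h1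
    have := ((padic_isSquare_iff hp h0).mp h).2
    rwa [natCast_leadingDigit_of_norm_eq_one h1] at this
  · intro h
    exact ((isSquare_iff_isSquare_toZMod hp hx).mpr h).map (PadicInt.Coe.ringHom)

/-- If |t| > 1, then t³ would strictly dominate the other two terms. -/
theorem norm_le_one_of_mem_cubicRoots {A B : ℤ_[p]} {t : ℚ_[p]}
    (ht : t ∈ cubicRoots (A : ℚ_[p]) B) : ‖t‖ ≤ 1 := by
  have ht : t ^ 3 + A * t = B := ht
  by_contra! h
  have e : t ^ 3 = B + -(A * t) := by linear_combination ht
  have h1 : ‖t ^ 3‖ ≤ ‖t‖ := by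
    rw [e]
    refine (Padic.nonarchimedean _ _).trans (max_le ?_ ?_)
    · exact B.2.trans h.le
    · rw [norm_neg, norm_mul]
      exact mul_le_of_le_one_left (norm_nonneg _) A.2
  rw [norm_pow] at h1
  exact h1.not_gt (by simpa using pow_lt_pow_right₀ h (show 1 < 3 by norm_num))

theorem exists_zmod_root_of_mem_cubicRoots {A B : ℤ_[p]} {t : ℚ_[p]}
    (ht : t ∈ cubicRoots (A : ℚ_[p]) B) :
    ∃ r, r ^ 3 + PadicInt.toZMod A * r = PadicInt.toZMod B := by
  obtain ⟨T, rfl⟩ : ∃ T : ℤ_[p], (T : ℚ_[p]) = t :=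
    ⟨⟨t, norm_le_one_of_mem_cubicRoots ht⟩, rfl⟩
  have ht' : (T : ℚ_[p]) ^ 3 + A * T = B := ht
  refine ⟨PadicInt.toZMod T, ?_⟩
  rw [← map_pow, ← map_mul, ← map_add]
  congr 1
  exact PadicInt.ext (by push_cast; exact ht')

theorem encard_cubicRoots_of_no_zmod_root {A B : ℤ_[p]}
    (h : ¬ ∃ r, r ^ 3 + PadicInt.toZMod A * r = PadicInt.toZMod B) :
    (cubicRoots (A : ℚ_[p]) B).encard = 0 := by
  rw [Set.encard_eq_zero, Set.eq_empty_iff_forall_notMem]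
  exact fun t ht => h (exists_zmod_root_of_mem_cubicRoots ht)

section UnitDiscriminant

variable {A B : ℤ_[p]}

/-- A nonzero discriminant mod p makes every root mod p simple, hence liftable. -/
theorem exists_mem_cubicRoots
    (hd : -4 * PadicInt.toZMod A ^ 3 - 27 * PadicInt.toZMod B ^ 2 ≠ 0)
    (h : ∃ r, r ^ 3 + PadicInt.toZMod A * r = PadicInt.toZMod B) :
    ∃ t, t ∈ cubicRoots (A : ℚ_[p]) B := by
  obtain ⟨r, hr⟩ := h
  obtain ⟨z, hz⟩ := exists_cubic_root_of_toZMod A B hr (by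
    intro h; apply hd; rw [cubic_discr_eq (r := r) hr, h]; ring)
  refine ⟨z, ?_⟩
  change (z : ℚ_[p]) ^ 3 + A * z = B
  exact_mod_cast congrArg (Subtype.val) hz

theorem isSquare_discr_iff (hp : 3 < p)
    (hd : -4 * PadicInt.toZMod A ^ 3 - 27 * PadicInt.toZMod B ^ 2 ≠ 0) :
    IsSquare (-4 * (A : ℚ_[p]) ^ 3 - 27 * (B : ℚ_[p]) ^ 2) ↔
      IsSquare (-4 * PadicInt.toZMod A ^ 3 - 27 * PadicInt.toZMod B ^ 2) := by
  have e : PadicInt.toZMod (-4 * A ^ 3 - 27 * B ^ 2) =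
      -4 * PadicInt.toZMod A ^ 3 - 27 * PadicInt.toZMod B ^ 2 := by
    simp only [map_mul, map_pow, map_sub, map_neg, map_ofNat]
  have := padic_coe_isSquare_iff hp (x := -4 * A ^ 3 - 27 * B ^ 2) (by rwa [e])
  rw [e] at this
  rw [← this]
  push_cast; rfl

theorem padic_discr_ne_zero
    (hd : -4 * PadicInt.toZMod A ^ 3 - 27 * PadicInt.toZMod B ^ 2 ≠ 0) :
    -4 * (A : ℚ_[p]) ^ 3 - 27 * (B : ℚ_[p]) ^ 2 ≠ 0 := by
  intro h
  have h' : -4 * A ^ 3 - 27 * B ^ 2 = 0 := by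
    apply PadicInt.ext; push_cast; exact h
  apply hd
  simpa only [map_mul, map_pow, map_sub, map_neg, map_ofNat, map_zero] using
    congrArg PadicInt.toZMod h'

theorem encard_cubicRoots_of_isSquare_zmod (hp : 3 < p)
    (hd : -4 * PadicInt.toZMod A ^ 3 - 27 * PadicInt.toZMod B ^ 2 ≠ 0)
    (h : ∃ r, r ^ 3 + PadicInt.toZMod A * r = PadicInt.toZMod B)
    (hs : IsSquare (-4 * PadicInt.toZMod A ^ 3 - 27 * PadicInt.toZMod B ^ 2)) :
    (cubicRoots (A : ℚ_[p]) B).encard = 3 := by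
  obtain ⟨t, ht⟩ := exists_mem_cubicRoots hd h
  exact encard_cubicRoots_eq_three two_ne_zero ht (padic_discr_ne_zero hd)
    ((isSquare_discr_iff hp hd).mpr hs)

theorem encard_cubicRoots_of_not_isSquare_zmod (hp : 3 < p)
    (hd : -4 * PadicInt.toZMod A ^ 3 - 27 * PadicInt.toZMod B ^ 2 ≠ 0)
    (h : ∃ r, r ^ 3 + PadicInt.toZMod A * r = PadicInt.toZMod B)
    (hs : ¬ IsSquare (-4 * PadicInt.toZMod A ^ 3 - 27 * PadicInt.toZMod B ^ 2)) :
    (cubicRoots (A : ℚ_[p]) B).encard = 1 := by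
  obtain ⟨t, ht⟩ := exists_mem_cubicRoots hd h
  exact encard_cubicRoots_eq_one ht fun h => hs ((isSquare_discr_iff hp hd).mp h)

end UnitDiscriminant

/-- A root of a cubic with a large constant term has a third of its valuation. -/
theorem three_dvd_valuation_of_mem_cubicRoots {A : ℤ_[p]} {b t : ℚ_[p]} (hb : 1 < ‖b‖)
    (ht : t ∈ cubicRoots (A : ℚ_[p]) b) : 3 ∣ b.valuation := by
  have ht : t ^ 3 + A * t = b := ht
  have hAt : ‖A * t‖ ≤ ‖t‖ := by
    rw [norm_mul]; exact mul_le_of_le_one_left (norm_nonneg _) A.2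
  have h1 : 1 < ‖t‖ := by
    by_contra! h
    have : ‖b‖ ≤ 1 := by
      rw [← ht]
      refine (Padic.nonarchimedean _ _).trans (max_le ?_ (hAt.trans h))
      rw [norm_pow]; exact pow_le_one₀ (norm_nonneg _) h
    linarith
  have h2 : ‖A * t‖ < ‖t ^ 3‖ := by
    rw [norm_pow]
    exact hAt.trans_lt (by simpa using pow_lt_pow_right₀ h1 (show 1 < 3 by norm_num))
  have h3 : ‖b‖ = ‖t ^ 3‖ := by
    rw [← ht, Padic.add_eq_max_of_ne h2.ne', max_eq_left h2.le]
  have hb0 : b ≠ 0 := by rintro rfl; simp at hb; linarith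
  have ht0 : t ≠ 0 := by rintro rfl; simp at h1; linarith
  have hp1 : (1 : ℝ) < p := by exact_mod_cast (Fact.out : p.Prime).one_lt
  rw [Padic.norm_eq_zpow_neg_valuation hb0, Padic.norm_eq_zpow_neg_valuation (pow_ne_zero 3 ht0)]
    at h3
  have h4 := zpow_right_injective₀ (by positivity) hp1.ne' h3
  rw [Padic.valuation_pow] at h4
  exact ⟨t.valuation, by push_cast at h4; linarith⟩

/-- Rescaling a cubic with a large constant term to an integral one whose linear coefficient
vanishes modulo `p`. -/
theorem exists_scaled_cubic (A : ℤ_[p]) {b : ℚ_[p]} (hb : 1 < ‖b‖) (h3 : 3 ∣ b.valuation) :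
    ∃ A' B' : ℤ_[p], PadicInt.toZMod A' = 0 ∧ PadicInt.toZMod B' = (leadingDigit b : ZMod p) ∧
      (cubicRoots (A : ℚ_[p]) b).encard = (cubicRoots (A' : ℚ_[p]) B').encard := by
  obtain ⟨k, hk⟩ := h3
  have hb0 : b ≠ 0 := by rintro rfl; simp at hb; linarith
  have hp0 : (p : ℚ_[p]) ≠ 0 := by exact_mod_cast (Fact.out : p.Prime).ne_zero
  have hk0 : k < 0 := by
    by_contra! h
    have := (Padic.norm_le_one_iff_val_nonneg b).mpr (by omega)
    linarith
  -- The scaling factor is p^(m+1) with 3(m + 1) = -ord b; the positive exponent makes the linear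
  -- coefficient vanish mod p.
  obtain ⟨m, hm⟩ : ∃ m : ℕ, -k = m + 1 := ⟨(-k - 1).toNat, by omega⟩
  have hc : (p : ℚ_[p]) ^ (m + 1) ≠ 0 := pow_ne_zero _ hp0
  refine ⟨((p : ℤ_[p]) ^ (m + 1)) ^ 2 * A, unitPartInt b, ?_, rfl, ?_⟩
  · simp
  · rw [← encard_cubicRoots_scale hc]
    have e : ((p : ℚ_[p]) ^ (m + 1)) ^ 3 * b = unitPart b := by
      rw [unitPart, hk, ← pow_mul, ← zpow_natCast]
      congr 2
      push_cast; omega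
    rw [e, coe_unitPartInt]
    push_cast; rfl

end Padic

/-! ### Root counts according to the size of b -/

section Counting

variable {p : ℕ} [Fact p.Prime]

theorem isSquare_mul_sq_iff {K : Type*} [Field K] {c x : K} (hc : c ≠ 0) :
    IsSquare (x * c ^ 2) ↔ IsSquare x := by
  constructor
  · rintro ⟨s, hs⟩
    refine ⟨s / c, ?_⟩
    field_simp
    rw [hs, sq]
  · rintro ⟨s, rfl⟩
    exact ⟨s * c, by ring⟩

theorem exists_coe_eq_neg_one_div_three (hp : 3 < p) :
    ∃ A : ℤ_[p], (A : ℚ_[p]) = -1 / 3 ∧ ‖A‖ = 1 ∧ 3 * PadicInt.toZMod A = -1 := by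
  have h3 : ‖(3 : ℚ_[p])‖ = 1 := by
    have := (Padic.norm_natCast_eq_one_iff (p := p) (n := 3)).mpr
      (Nat.coprime_primes Fact.out Nat.prime_three |>.mpr (by omega))
    exact_mod_cast this
  have h : ‖(-1 / 3 : ℚ_[p])‖ = 1 := by rw [norm_div, norm_neg, norm_one, h3, div_one]
  obtain ⟨A, hA⟩ : ∃ A : ℤ_[p], (A : ℚ_[p]) = -1 / 3 := ⟨⟨-1 / 3, h.le⟩, rfl⟩
  refine ⟨A, hA, by rw [PadicInt.norm_def, hA, h], ?_⟩
  have e : 3 * A = -1 := by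
    have h' : (3 : ℚ_[p]) * A = -1 := by rw [hA]; norm_num
    apply PadicInt.ext; push_cast; exact h'
  have := congrArg PadicInt.toZMod e
  simpa only [map_mul, map_ofNat, map_neg, map_one] using this

section LargeNorm

variable {A : ℤ_[p]} {b : ℚ_[p]}

theorem encard_cubicRoots_of_not_three_dvd (hb : 1 < ‖b‖) (h3 : ¬ 3 ∣ b.valuation) :
    (cubicRoots (A : ℚ_[p]) b).encard = 0 := by
  rw [Set.encard_eq_zero, Set.eq_empty_iff_forall_notMem]
  exact fun t ht => h3 (three_dvd_valuation_of_mem_cubicRoots hb ht)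

/-- After rescaling, the residual equation is r³ = β with discriminant -3(3β)², so the count rests
on cubes and on whether -3 is a square. -/
theorem encard_cubicRoots_of_mod_three_eq_two (hp : 3 < p) (hp3 : p % 3 = 2) (hb : 1 < ‖b‖)
    (h3 : 3 ∣ b.valuation) : (cubicRoots (A : ℚ_[p]) b).encard = 1 := by
  obtain ⟨A', B', hA', hB', h⟩ := exists_scaled_cubic A hb h3
  have hb0 : b ≠ 0 := by rintro rfl; simp at hb; linarith
  have hβ := natCast_leadingDigit_ne_zero hb0
  rw [← hB'] at hβ
  have hc := mul_ne_zero (three_ne_zero_zmod hp) hβ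
  have e : -4 * PadicInt.toZMod A' ^ 3 - 27 * PadicInt.toZMod B' ^ 2 =
      -3 * (3 * PadicInt.toZMod B') ^ 2 := by rw [hA']; ring
  rw [h]
  apply encard_cubicRoots_of_not_isSquare_zmod hp
  · rw [e]
    exact mul_ne_zero (neg_ne_zero.mpr (three_ne_zero_zmod hp)) (pow_ne_zero 2 hc)
  · obtain ⟨r, hr⟩ := exists_cube_eq_of_mod_three_eq_two hp3 (PadicInt.toZMod B')
    exact ⟨r, by rw [hA', hr]; ring⟩
  · rw [e, isSquare_mul_sq_iff hc, isSquare_neg_three_iff hp]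
    omega

theorem encard_cubicRoots_of_leadingDigit_pow_eq_one (hp : 3 < p) (hp3 : p % 3 = 1)
    (hb : 1 < ‖b‖) (h3 : 3 ∣ b.valuation)
    (hpow : (leadingDigit b : ZMod p) ^ ((p - 1) / 3) = 1) :
    (cubicRoots (A : ℚ_[p]) b).encard = 3 := by
  obtain ⟨A', B', hA', hB', h⟩ := exists_scaled_cubic A hb h3
  have hb0 : b ≠ 0 := by rintro rfl; simp at hb; linarith
  have hβ := natCast_leadingDigit_ne_zero hb0
  rw [← hB'] at hβ hpow
  have hc := mul_ne_zero (three_ne_zero_zmod hp) hβ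
  have e : -4 * PadicInt.toZMod A' ^ 3 - 27 * PadicInt.toZMod B' ^ 2 =
      -3 * (3 * PadicInt.toZMod B') ^ 2 := by rw [hA']; ring
  rw [h]
  apply encard_cubicRoots_of_isSquare_zmod hp
  · rw [e]
    exact mul_ne_zero (neg_ne_zero.mpr (three_ne_zero_zmod hp)) (pow_ne_zero 2 hc)
  · obtain ⟨r, hr⟩ := (exists_cube_eq_iff hp3 hβ).mpr hpow
    exact ⟨r, by rw [hA', hr]; ring⟩
  · rw [e, isSquare_mul_sq_iff hc, isSquare_neg_three_iff hp]
    exact hp3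

theorem encard_cubicRoots_of_leadingDigit_pow_ne_one (hp3 : p % 3 = 1)
    (hb : 1 < ‖b‖) (h3 : 3 ∣ b.valuation)
    (hpow : (leadingDigit b : ZMod p) ^ ((p - 1) / 3) ≠ 1) :
    (cubicRoots (A : ℚ_[p]) b).encard = 0 := by
  obtain ⟨A', B', hA', hB', h⟩ := exists_scaled_cubic A hb h3
  have hb0 : b ≠ 0 := by rintro rfl; simp at hb; linarith
  have hβ := natCast_leadingDigit_ne_zero hb0
  rw [← hB'] at hβ hpow
  rw [h]
  apply encard_cubicRoots_of_no_zmod_root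
  rintro ⟨r, hr⟩
  exact hpow ((exists_cube_eq_iff hp3 hβ).mp ⟨r, by rw [← hr, hA']; ring⟩)

end LargeNorm

section SmallNorm

variable {A B : ℤ_[p]}

theorem discr_zmod_of_const_eq_zero (hp : 3 < p) (hA : PadicInt.toZMod A ≠ 0)
    (hB : PadicInt.toZMod B = 0) :
    -4 * PadicInt.toZMod A ^ 3 - 27 * PadicInt.toZMod B ^ 2 ≠ 0 ∧
    (IsSquare (-4 * PadicInt.toZMod A ^ 3 - 27 * PadicInt.toZMod B ^ 2) ↔
      IsSquare (-PadicInt.toZMod A)) := by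
  have hc := mul_ne_zero (two_ne_zero_zmod hp) hA
  have e : -4 * PadicInt.toZMod A ^ 3 - 27 * PadicInt.toZMod B ^ 2 =
      -PadicInt.toZMod A * (2 * PadicInt.toZMod A) ^ 2 := by rw [hB]; ring
  refine ⟨?_, ?_⟩
  · rw [e]; exact mul_ne_zero (neg_ne_zero.mpr hA) (pow_ne_zero 2 hc)
  · rw [e, isSquare_mul_sq_iff hc]

theorem encard_cubicRoots_of_isSquare_neg (hp : 3 < p) (hA : PadicInt.toZMod A ≠ 0)
    (hB : PadicInt.toZMod B = 0) (hs : IsSquare (-PadicInt.toZMod A)) :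
    (cubicRoots (A : ℚ_[p]) B).encard = 3 :=
  have h := discr_zmod_of_const_eq_zero hp hA hB
  encard_cubicRoots_of_isSquare_zmod hp h.1 ⟨0, by simp [hB]⟩ (h.2.mpr hs)

theorem encard_cubicRoots_of_not_isSquare_neg (hp : 3 < p) (hA : PadicInt.toZMod A ≠ 0)
    (hB : PadicInt.toZMod B = 0) (hs : ¬ IsSquare (-PadicInt.toZMod A)) :
    (cubicRoots (A : ℚ_[p]) B).encard = 1 :=
  have h := discr_zmod_of_const_eq_zero hp hA hB
  encard_cubicRoots_of_not_isSquare_zmod hp h.1 ⟨0, by simp [hB]⟩ (mt h.2.mp hs)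

end SmallNorm

/-- If the discriminant vanishes modulo `p`, the cubic still has a simple root. -/
theorem exists_mem_cubicRoots_of_discr_eq_zero (hp : 3 < p) {A B : ℤ_[p]}
    (hA : 3 * PadicInt.toZMod A = -1)
    (hd : -4 * PadicInt.toZMod A ^ 3 - 27 * PadicInt.toZMod B ^ 2 = 0) :
    ∃ t, t ∈ cubicRoots (A : ℚ_[p]) B := by
  set α := PadicInt.toZMod A
  set β := PadicInt.toZMod B
  have h3 := three_ne_zero_zmod hp
  have hβ : 729 * β ^ 2 = 4 := by
    have e : 27 * α ^ 3 = -1 := by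
      linear_combination (9 * α ^ 2 - 3 * α + 1) * hA
    linear_combination -27 * hd - 4 * e
  -- For a = -1/3 and zero discriminant the simple root is -3b/a = 9b; there the derivative 3r² + a
  -- equals 1.
  obtain ⟨z, hz⟩ := exists_cubic_root_of_toZMod A B (r := 9 * β)
    (by
      apply mul_left_cancel₀ h3
      linear_combination 3 * β * hβ + 9 * β * hA)
    (by
      intro h
      have h' : (3 : ZMod p) * (3 * (9 * β) ^ 2 + α) = 3 := by
        linear_combination hβ + hA
      rw [h, mul_zero] at h'
      exact h3 h'.symm)
  refine ⟨z, ?_⟩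
  change (z : ℚ_[p]) ^ 3 + A * z = B
  exact_mod_cast congrArg (Subtype.val) hz

end Counting

theorem norm_two_div_twentySeven {p : ℕ} [Fact p.Prime] (hp : 3 < p) :
    ‖(2 / 27 : ℚ_[p])‖ = 1 := by
  have h2 : ‖(2 : ℚ_[p])‖ = 1 := by
    have := (Padic.norm_natCast_eq_one_iff (p := p) (n := 2)).mpr
      (Nat.coprime_primes Fact.out Nat.prime_two |>.mpr (by omega))
    exact_mod_cast this
  have h3 : ‖(3 : ℚ_[p])‖ = 1 := by
    have := (Padic.norm_natCast_eq_one_iff (p := p) (n := 3)).mpr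
      (Nat.coprime_primes Fact.out Nat.prime_three |>.mpr (by omega))
    exact_mod_cast this
  have : (27 : ℚ_[p]) = 3 ^ 3 := by norm_num
  rw [this, norm_div, norm_pow, h2, h3]; norm_num

/-! ### Assembly of the cases -/

theorem mainTheorem2 (p : ℕ) [Fact p.Prime] (hp : 3 < p) (lam : c0 p)
    (θ b D : ℚ_[p]) (a₀ b₀ d₀ D₀ u : ℤ)
    (hθ : θ = seriesSum lam)
    (hb : b = θ + 2 / 27)
    (hD : D = 4 / 27 - 27 * unitPart b ^ 2)
    (ha₀ : a₀ = leadingDigit (-1 / 3 : ℚ_[p]))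
    (hb₀ : b₀ = leadingDigit b)
    (hd₀ : d₀ = leadingDigit D)
    (hD₀ : D₀ = -4 * a₀ ^ 3 - 27 * b₀ ^ 2)
    (hu : u = uSeq a₀ b₀ (p - 2)) :
    (ThreeCond p b D a₀ b₀ d₀ u → (fixF lam).encard = 3) ∧
    (TwoCond p θ b D → (fixF lam).encard = 2) ∧
    (OneCond p θ b D a₀ d₀ D₀ u → (fixF lam).encard = 1) ∧
    (¬ ThreeCond p b D a₀ b₀ d₀ u → ¬ TwoCond p θ b D → ¬ OneCond p θ b D a₀ d₀ D₀ u →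
      (fixF lam).encard = 0) := by
  have hmod : ∀ x y : ℤ, x ≡ y [ZMOD p] ↔ (x : ZMod p) = y := fun x y =>
    (ZMod.intCast_eq_intCast_iff x y p).symm
  obtain ⟨A, hA, hA1, hα⟩ := exists_coe_eq_neg_one_div_three hp
  have ha : (a₀ : ZMod p) = PadicInt.toZMod A := by
    rw [ha₀, ← hA, Int.cast_natCast, natCast_leadingDigit_of_norm_eq_one hA1]
  have hA0 : PadicInt.toZMod A ≠ 0 := by
    intro h; rw [h] at hα; simp at hα
  have hbd : (b₀ : ZMod p) = leadingDigit b := by rw [hb₀, Int.cast_natCast]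
  by_cases hθ0 : θ = 0
  · have hN := encard_fixF_of_eq_zero (lam := lam) (by rw [← hθ, hθ0])
    have hb1 : ‖b‖ = 1 := by rw [hb, hθ0, zero_add, norm_two_div_twentySeven hp]
    have hD0 : D = 0 := by
      rw [hD, unitPart_of_norm_eq_one hb1, hb, hθ0]; norm_num
    simp [ThreeCond, TwoCond, OneCond, hN, hb1, hD0, hθ0]
  have hN : (fixF lam).encard = (cubicRoots (A : ℚ_[p]) b).encard := by
    rw [encard_fixF_of_ne_zero (by rwa [← hθ]), hA, hb, hθ]
  rw [hN]
  rcases lt_trichotomy ‖b‖ 1 with hb1 | hb1 | hb1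
  · obtain ⟨B, rfl⟩ : ∃ B : ℤ_[p], (B : ℚ_[p]) = b := ⟨⟨b, hb1.le⟩, rfl⟩
    have hB : PadicInt.toZMod B = 0 := (toZMod_eq_zero_iff B).mpr hb1
    have hb2 : ¬ 1 < ‖(B : ℚ_[p])‖ ^ 2 := by
      rw [not_lt]; exact pow_le_one₀ (norm_nonneg _) hb1.le
    have hsq := isSquare_zmod_iff_pow_modEq hp (d := -a₀) (by
      rw [Int.cast_neg, ha]; exact neg_ne_zero.mpr hA0)
    rw [Int.cast_neg, ha] at hsq
    by_cases hs : IsSquare (-PadicInt.toZMod A)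
    · have hN := encard_cubicRoots_of_isSquare_neg hp hA0 hB hs
      have hs' := hsq.mp hs
      simp only [ThreeCond, TwoCond, OneCond, hN, hb1, hb1.ne, hb1.not_gt, hb2, hs', true_and,
        false_and, and_true, not_true_eq_false, or_false, false_or, false_imp_iff, true_imp_iff]
    · have hN := encard_cubicRoots_of_not_isSquare_neg hp hA0 hB hs
      have hs' := mt hsq.mpr hs
      simp only [ThreeCond, TwoCond, OneCond, hN, hb1, hb1.ne, hb1.not_gt, hb2, hs', false_and,
        and_false, and_true, not_true_eq_false, not_false_eq_true, or_false, false_or,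
        false_imp_iff, true_imp_iff]
  · obtain ⟨B, hB⟩ : ∃ B : ℤ_[p], (B : ℚ_[p]) = b := ⟨⟨b, hb1.le⟩, rfl⟩
    have hBn : ‖B‖ = 1 := by rw [PadicInt.norm_def, hB, hb1]
    have hβ : (b₀ : ZMod p) = PadicInt.toZMod B := by
      rw [hbd, ← hB, natCast_leadingDigit_of_norm_eq_one hBn]
    have hβ0 : (b₀ : ZMod p) ≠ 0 := by
      rw [hbd]; exact natCast_leadingDigit_ne_zero (by rintro rfl; simp at hb1)
    rw [unitPart_of_norm_eq_one hb1] at hD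
    have hDA : -4 * (A : ℚ_[p]) ^ 3 - 27 * b ^ 2 = D := by rw [hA, hD]; ring
    have hDn : ‖-4 * A ^ 3 - 27 * B ^ 2‖ = ‖D‖ := by
      rw [PadicInt.norm_def, ← hDA, ← hB]; push_cast; rfl
    have hDz : PadicInt.toZMod (-4 * A ^ 3 - 27 * B ^ 2) =
        -4 * (a₀ : ZMod p) ^ 3 - 27 * (b₀ : ZMod p) ^ 2 := by
      simp only [map_mul, map_pow, map_sub, map_neg, map_ofNat, ha, hβ]
    have hD₀z : (D₀ : ZMod p) = -4 * (a₀ : ZMod p) ^ 3 - 27 * (b₀ : ZMod p) ^ 2 := by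
      rw [hD₀]; push_cast; rfl
    have hDle : ‖D‖ ≤ 1 := hDn ▸ PadicInt.norm_le_one _
    have hred : -4 * (a₀ : ZMod p) ^ 3 - 27 * (b₀ : ZMod p) ^ 2 = 0 ↔ ‖D‖ < 1 := by
      rw [← hDz, toZMod_eq_zero_iff, hDn]
    rcases hDle.lt_or_eq with hD1 | hD1
    · have h0 := hred.mpr hD1
      -- This rules out the alternative of `OneCond` that does not mention the size of D.
      have hDu : D₀ * u ^ 2 ≡ 0 [ZMOD p] := by
        rw [hmod]; push_cast; rw [hD₀z, h0, zero_mul]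
      by_cases hD0 : D = 0
      · have hbn : b = -2 / 27 := by
          -- D = 0 leaves b = ±2/27, and the plus sign is the case θ = 0 already treated.
          have : (b - 2 / 27) * (b + 2 / 27) = 0 := by
            rw [hD0] at hD; linear_combination hD / 27
          rcases mul_eq_zero.mp this with h | h
          · exact absurd (by linear_combination h - hb) hθ0
          · linear_combination h
        have hN : (cubicRoots (A : ℚ_[p]) b).encard = 2 := by
          rw [hA, hbn, encard_cubicRoots_of_eq_neg]
        simp [ThreeCond, TwoCond, OneCond, hN, hb1, hD0, hθ0, hDu]
      · obtain ⟨t, ht⟩ := exists_mem_cubicRoots_of_discr_eq_zero hp (A := A) (B := B) hα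
          (by rw [← ha, ← hβ, h0])
        rw [hB] at ht
        have hDpos : 0 < ‖D‖ := norm_pos_iff.mpr hD0
        have hd0 : (d₀ : ZMod p) ≠ 0 := by
          rw [hd₀, Int.cast_natCast]; exact natCast_leadingDigit_ne_zero hD0
        have hsq : IsSquare D ↔ 2 ∣ D.valuation ∧ d₀ ^ ((p - 1) / 2) ≡ 1 [ZMOD p] := by
          rw [padic_isSquare_iff hp hD0, ← isSquare_zmod_iff_pow_modEq hp hd0, hd₀,
            Int.cast_natCast]
        by_cases hs : IsSquare D
        · have hN := encard_cubicRoots_eq_three two_ne_zero ht (by rwa [hDA]) (by rwa [hDA])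
          obtain ⟨hv, hd⟩ := hsq.mp hs
          simp [ThreeCond, TwoCond, OneCond, hN, hb1, hD0, hD1, hDu, hv, hd]
        · have hN := encard_cubicRoots_eq_one ht (by rwa [hDA])
          rw [hsq] at hs
          by_cases hv : 2 ∣ D.valuation
          · have hd : ¬ d₀ ^ ((p - 1) / 2) ≡ 1 [ZMOD p] := fun hd => hs ⟨hv, hd⟩
            simp [ThreeCond, TwoCond, OneCond, hN, hb1, hD0, hD1, hD1.ne, hDu, hv, hd]
          · simp [ThreeCond, TwoCond, OneCond, hN, hb1, hD0, hD1, hD1.ne, hDu, hv]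
    · have h0 : -4 * (a₀ : ZMod p) ^ 3 - 27 * (b₀ : ZMod p) ^ 2 ≠ 0 := by
        rw [Ne, hred, hD1]; exact lt_irrefl 1
      have hD0 : D ≠ 0 := by rintro rfl; simp at hD1
      have hum : u ≡ 0 [ZMOD p] ↔ (uSeq a₀ b₀ (p - 2) : ZMod p) = 0 := by
        rw [hmod, hu, Int.cast_zero]
      have hum0 : D₀ * u ^ 2 ≡ 0 [ZMOD p] ↔ (uSeq a₀ b₀ (p - 2) : ZMod p) = 0 := by
        rw [hmod]; push_cast; rw [hD₀z, hu, mul_eq_zero, or_iff_right h0,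
          pow_eq_zero_iff two_ne_zero]
      have hum9 : D₀ * u ^ 2 ≡ 9 * a₀ ^ 2 [ZMOD p] ↔
          (-4 * a₀ ^ 3 - 27 * b₀ ^ 2 : ZMod p) * (uSeq a₀ b₀ (p - 2) : ZMod p) ^ 2 =
            9 * a₀ ^ 2 := by
        rw [hmod]; push_cast; rw [hD₀z, hu]
      by_cases hr : ∃ r : ZMod p, r ^ 3 + a₀ * r = b₀
      · obtain ⟨r, hr'⟩ := hr
        rcases cubic_zmod_of_root hp hβ0 h0 hr' with ⟨hs, hu0⟩ | ⟨hs, hu0, hu9⟩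
        · have hN := encard_cubicRoots_of_isSquare_zmod (A := A) (B := B) hp
            (by rwa [← ha, ← hβ]) ⟨r, by rw [← ha, ← hβ, hr']⟩ (by rwa [← ha, ← hβ])
          rw [hB] at hN
          have h1 := hum.mpr hu0
          have h2 := hum0.mpr hu0
          simp [ThreeCond, TwoCond, OneCond, hN, hb1, hD0, hD1, h1, h2]
        · have hN := encard_cubicRoots_of_not_isSquare_zmod (A := A) (B := B) hp
            (by rwa [← ha, ← hβ]) ⟨r, by rw [← ha, ← hβ, hr']⟩ (by rwa [← ha, ← hβ])
          rw [hB] at hN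
          have h1 := mt hum.mp hu0
          have h2 := mt hum0.mp hu0
          have h3 := mt hum9.mp hu9
          simp [ThreeCond, TwoCond, OneCond, hN, hb1, hD0, hD1, h1, h2, h3]
      · obtain ⟨hu0, hu9⟩ := cubic_zmod_of_no_root hp (by rwa [ha]) h0 hr
        have hN := encard_cubicRoots_of_no_zmod_root (A := A) (B := B) (by rwa [← ha, ← hβ])
        rw [hB] at hN
        have h1 := mt hum.mp hu0
        have h3 := hum9.mpr hu9
        simp only [ThreeCond, TwoCond, OneCond, hN, hb1, hD0, hD1, h1, h3, lt_irrefl, false_and,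
          and_false, true_and, one_pow, not_true_eq_false, not_false_eq_true, or_false,
          false_imp_iff, true_imp_iff]
  · have hb2 : 1 < ‖b‖ ^ 2 := one_lt_pow₀ hb1 two_ne_zero
    by_cases h3 : 3 ∣ b.valuation
    · have hb0m : b₀ ^ ((p - 1) / 3) ≡ 1 [ZMOD p] ↔
          (leadingDigit b : ZMod p) ^ ((p - 1) / 3) = 1 := by
        rw [hmod]; push_cast; rw [hbd]
      have hcases : p % 3 = 1 ∨ p % 3 = 2 := by
        have : ¬ 3 ∣ p := fun h =>
          absurd ((Nat.prime_dvd_prime_iff_eq Nat.prime_three Fact.out).mp h) (by omega)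
        omega
      rcases hcases with hp3 | hp3
      · have hm1 : p ≡ 1 [MOD 3] := hp3
        have hm2 : ¬ p ≡ 2 [MOD 3] := fun h => by
          have : p % 3 = 2 := h
          omega
        by_cases hpow : (leadingDigit b : ZMod p) ^ ((p - 1) / 3) = 1
        · have hN := encard_cubicRoots_of_leadingDigit_pow_eq_one (A := A) hp hp3 hb1 h3 hpow
          have h := hb0m.mpr hpow
          simp [ThreeCond, TwoCond, OneCond, hN, hb1.ne', hb1.not_gt, hb2, h3, hm1, hm2, h]
        · have hN := encard_cubicRoots_of_leadingDigit_pow_ne_one (A := A) hp3 hb1 h3 hpow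
          have h := mt hb0m.mp hpow
          simp [ThreeCond, TwoCond, OneCond, hN, hb1.ne', hb1.not_gt, hm2, h]
      · have hm2 : p ≡ 2 [MOD 3] := hp3
        have hm1 : ¬ p ≡ 1 [MOD 3] := fun h => by
          have : p % 3 = 1 := h
          omega
        have hN := encard_cubicRoots_of_mod_three_eq_two (A := A) hp hp3 hb1 h3
        simp [ThreeCond, TwoCond, OneCond, hN, hb1, hb1.ne', hb1.not_gt, h3, hm1, hm2]
    · have hN := encard_cubicRoots_of_not_three_dvd (A := A) hb1 h3
      simp [ThreeCond, TwoCond, OneCond, hN, hb1.ne', hb1.not_gt, h3]
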